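/- For a prime $p$ and positive integers $k, n$, let $r_k(\mathbb{F}_p^n)$ denote the largest cardinality of a subset $S \subseteq \mathbb{F}_p^n$ that contains no $k$ points in arithmetic progression, that is, no $k$ pairwise distinct points of the form $a, a+d, \dots, a+(k-1)d$ with $a, d \in \mathbb{F}_p^n$. Then $$r_7(\mathbb{F}_7^3) < 243.$$ -/

import Mathlib

/-- `S` contains no `k` points in arithmetic progression: there are no `a`, `d` such that the `k`
points `a, a + d, …, a + (k - 1) d` are pairwise distinct and all lie in `S`. -/
def ProgressionFree {G : Type*} [AddCommGroup G] (k : ℕ) (S : Set G) : Prop :=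
  ∀ a d : G, Function.Injective (fun i : Fin k => a + (i : ℕ) • d) →
    ∃ i : Fin k, a + (i : ℕ) • d ∉ S

open Classical in
/-- `r k p n` is `r_k(𝔽_p^n)`: the largest cardinality of a subset of `𝔽_p^n` that contains no
`k` points in arithmetic progression (`p` is a prime). -/
noncomputable def r (k p n : ℕ) [NeZero p] : ℕ :=
  (Finset.univ.filter
    (fun S : Finset (Fin n → ZMod p) => ProgressionFree k (S : Set (Fin n → ZMod p)))).sup Finset.card

open Finset

/-! A progression-free set with at least 243 points shrinks to one with exactly 243, whose
complement `B` has 100 points and meets every line. By Jamison's bound every plane holds at least 13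
points of `B`, so the excesses over 13 on seven parallel planes are nonnegative with sum 9.

Two counts of the nonzero functionals with a plane of excess 9 (22 points) now collide. Counting
pairs of points fixes the total of the squared excesses; a functional contributes at most 8² + 1²
unless one plane takes all 9, so at least 160 functionals have such a plane. Conversely, fix one
22-point plane and sum over the pencils of planes through its lines. The squares required of the
other planes limit the number of its 2-point lines, and this leaves at most 144 functionals. -/

instance : Fact (Nat.Prime 7) := ⟨by norm_num⟩

/-- The vector space `𝔽_7^3`, also used as its own dual through the dot product. -/
abbrev V7 : Type := Fin 3 → ZMod 7

/-- The number of points of `B` on the hyperplane `φ ⬝ᵥ x = c`. -/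
def planeCount (B : Finset V7) (φ : V7) (c : ZMod 7) : ℤ := #{b ∈ B | φ ⬝ᵥ b = c}

/-- The functionals that are not multiples of `φ`. -/
def transversal (φ : V7) : Finset V7 := {ψ | ∀ t : ZMod 7, t • φ ≠ ψ}

/-- `B` meets every line. -/
def BlocksLines (B : Finset V7) : Prop :=
  ∀ a d : V7, d ≠ 0 → ∃ i : ℕ, i < 7 ∧ a + i • d ∈ B

theorem mem_transversal {φ ψ : V7} : ψ ∈ transversal φ ↔ ∀ t : ZMod 7, t • φ ≠ ψ := by
  simp [transversal]

/-- Two non-parallel planes share a line, which `B` blocks. -/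
theorem BlocksLines.exists_mem {B : Finset V7} (hB : BlocksLines B) {φ ψ : V7} (hφ : φ ≠ 0)
    (hψ : ψ ∈ transversal φ) (c e : ZMod 7) : ∃ b ∈ B, φ ⬝ᵥ b = c ∧ ψ ⬝ᵥ b = e := by
  have hli : LinearIndependent (ZMod 7) ![φ, ψ] :=
    (LinearIndependent.pair_iff' hφ).2 (mem_transversal.1 hψ)
  let M : Matrix (Fin 2) (Fin 3) (ZMod 7) := Matrix.of ![φ, ψ]
  have hrank : M.rank = 2 := by
    have := LinearIndependent.rank_matrix (M := M) hli
    simpa using this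
  have hsurj : Function.Surjective M.mulVecLin := by
    rw [← LinearMap.range_eq_top]
    apply Submodule.eq_top_of_finrank_eq
    rw [← Matrix.rank, hrank]
    simp
  have hker : LinearMap.ker M.mulVecLin ≠ ⊥ :=
    LinearMap.ker_ne_bot_of_finrank_lt (by simp)
  obtain ⟨d, hd, hd0⟩ := (Submodule.ne_bot_iff _).1 hker
  obtain ⟨a, ha⟩ := hsurj ![c, e]
  obtain ⟨i, -, hi⟩ := hB a d hd0
  have e0 := congrFun ha 0
  have e1 := congrFun ha 1
  have d0 := congrFun (LinearMap.mem_ker.1 hd) 0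
  have d1 := congrFun (LinearMap.mem_ker.1 hd) 1
  simp [M, Matrix.mulVec] at e0 e1 d0 d1
  refine ⟨_, hi, ?_, ?_⟩
  · rw [dotProduct_add, dotProduct_smul]
    exact (congrArg₂ (fun x y => x + i • y) e0 d0).trans (by simp)
  · rw [dotProduct_add, dotProduct_smul]
    exact (congrArg₂ (fun x y => x + i • y) e1 d1).trans (by simp)

theorem card_transversal {φ : V7} (hφ : φ ≠ 0) : #(transversal φ) = 336 := by
  have h : transversal φ = univ \ univ.image (fun t : ZMod 7 => t • φ) := by
    ext ψ; simp [mem_transversal]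
  rw [h, card_univ_sdiff, card_image_of_injective _ (smul_left_injective _ hφ)]
  simp [ZMod.card]

theorem card_orthogonal {v : V7} (hv : v ≠ 0) : #{φ : V7 | φ ⬝ᵥ v = 0} = 49 := by
  let f : V7 →ₗ[ZMod 7] ZMod 7 := (dotProductBilin (ZMod 7) (ZMod 7)).flip v
  have hf : f ≠ 0 := by
    intro h
    apply hv
    ext i
    have := LinearMap.congr_fun h (Pi.single i 1)
    simpa [f] using this
  have h1 := Module.Dual.finrank_ker_add_one_of_ne_zero (f := f) hf
  have h2 := Module.natCard_eq_pow_finrank (K := ZMod 7) (V := LinearMap.ker f)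
  have h3 : Module.finrank (ZMod 7) (LinearMap.ker f) = 2 := by
    simp at h1; omega
  rw [h3, Nat.card_zmod] at h2
  rw [← Fintype.card_subtype, Fintype.card_eq_nat_card]
  exact h2

theorem card_nonzero_orthogonal {v : V7} (hv : v ≠ 0) :
    #{φ ∈ univ.erase (0 : V7) | φ ⬝ᵥ v = 0} = 48 := by
  rw [filter_erase, card_erase_of_mem (by simp), card_orthogonal hv]

theorem card_transversal_orthogonal {φ v : V7} (hφ : φ ≠ 0) (hv : v ≠ 0) (h : φ ⬝ᵥ v = 0) :
    #{ψ ∈ transversal φ | ψ ⬝ᵥ v = 0} = 42 := by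
  have h' : ({ψ ∈ transversal φ | ψ ⬝ᵥ v = 0} : Finset V7) =
      ({ψ : V7 | ψ ⬝ᵥ v = 0} : Finset V7) \ univ.image (fun t : ZMod 7 => t • φ) := by
    ext ψ; simp [mem_transversal, and_comm]
  rw [h', card_sdiff_of_subset, card_orthogonal hv,
    card_image_of_injective _ (smul_left_injective _ hφ)]
  · simp [ZMod.card]
  · intro ψ
    simp only [mem_image, mem_univ, true_and, mem_filter]
    rintro ⟨t, rfl⟩
    simp [h]

theorem transversal_nonempty {φ : V7} (hφ : φ ≠ 0) : (transversal φ).Nonempty := by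
  rw [← card_pos, card_transversal hφ]; norm_num

/-- Jamison's bound in a plane of `𝔽_7^3`. -/
theorem BlocksLines.thirteen_le {B : Finset V7} (hB : BlocksLines B) {φ : V7} (hφ : φ ≠ 0)
    (c : ZMod 7) : 13 ≤ planeCount B φ c := by
  classical
  obtain ⟨ψ₀, hψ₀⟩ := transversal_nonempty hφ
  obtain ⟨b₀, hb₀, hφb₀, -⟩ := hB.exists_mem hφ hψ₀ c 0
  set A : Finset V7 := {b ∈ B | φ ⬝ᵥ b = c} with hA
  have hb₀A : b₀ ∈ A := by simp [hA, hb₀, hφb₀]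
  by_contra! hlt
  have hcard : #(A.erase b₀) ≤ 11 := by
    rw [card_erase_of_mem hb₀A]
    unfold planeCount at hlt
    rw [← hA] at hlt
    omega
  obtain ⟨i, hi⟩ : ∃ i, φ i ≠ 0 := Function.ne_iff.1 hφ
  let L : V7 → MvPolynomial (Fin 3) (ZMod 7) := fun v =>
    ∑ j, MvPolynomial.C (v j) * MvPolynomial.X j
  have hLdeg (v : V7) : (L v - 1).totalDegree ≤ 1 := by
    refine (MvPolynomial.totalDegree_sub _ _).trans (max_le ?_ (by simp))
    refine MvPolynomial.totalDegree_finsetSum_le fun j _ => ?_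
    refine (MvPolynomial.totalDegree_mul _ _).trans ?_
    simp
  have hLeval (v x : V7) : MvPolynomial.eval x (L v) = x ⬝ᵥ v := by
    simp [L, dotProduct, mul_comm]
  -- Degree at most 11 + 6 < 18 makes the values of `F` sum to zero, yet `F` vanishes exactly off
  -- the origin: a blocked line kills a linear factor at each transversal `x`, and the last factor
  -- kills the nonzero multiples of `φ`.
  let F : MvPolynomial (Fin 3) (ZMod 7) :=
    (∏ b ∈ A.erase b₀, (L (b - b₀) - 1)) * (1 - MvPolynomial.X i ^ 6)
  have hFdeg : F.totalDegree < (Fintype.card (ZMod 7) - 1) * Fintype.card (Fin 3) := by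
    have h1 : (∏ b ∈ A.erase b₀, (L (b - b₀) - 1)).totalDegree ≤ 11 := by
      refine (MvPolynomial.totalDegree_finsetProd _ _).trans ?_
      refine (sum_le_card_nsmul _ _ 1 fun b _ => hLdeg _).trans ?_
      simpa using hcard
    have h2 : (1 - MvPolynomial.X i ^ 6 : MvPolynomial (Fin 3) (ZMod 7)).totalDegree ≤ 6 :=
      (MvPolynomial.totalDegree_sub _ _).trans (by simp)
    have := MvPolynomial.totalDegree_mul (∏ b ∈ A.erase b₀, (L (b - b₀) - 1))
      (1 - MvPolynomial.X i ^ 6)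
    simp only [ZMod.card, Fintype.card_fin, F]
    omega
  have hsum := MvPolynomial.sum_eval_eq_zero F hFdeg
  have hFeval (x : V7) : MvPolynomial.eval x F =
      (∏ b ∈ A.erase b₀, (x ⬝ᵥ (b - b₀) - 1)) * (1 - x i ^ 6) := by
    simp [F, map_prod, hLeval]
  rw [Finset.sum_eq_single 0] at hsum
  · rw [hFeval] at hsum
    simp at hsum
  · intro x _ hx
    rw [hFeval]
    by_cases hxt : x ∈ transversal φ
    · obtain ⟨b, hb, hb1, hb2⟩ := hB.exists_mem hφ hxt c (x ⬝ᵥ b₀ + 1)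
      have hne : b ≠ b₀ := by
        rintro rfl
        simp at hb2
      rw [prod_eq_zero (i := b) (by simp [hA, hne, hb, hb1]) (by simp [dotProduct_sub, hb2]),
        zero_mul]
    · obtain ⟨t, rfl⟩ : ∃ t : ZMod 7, t • φ = x := by
        simpa [mem_transversal] using hxt
      have ht : t ≠ 0 := by rintro rfl; simp at hx
      have h6 : (t • φ) i ^ 6 = 1 := by
        have := ZMod.pow_card_sub_one_eq_one (p := 7) (a := (t • φ) i)
          (by simp [ht, hi])
        simpa using this
      rw [h6]; simp
  · simp

/-! ### Moments of plane counts and pencils of planes -/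

theorem sum_planeCount (B : Finset V7) (φ : V7) : ∑ c, planeCount B φ c = #B := by
  unfold planeCount
  rw [← Nat.cast_sum, ← card_eq_sum_card_fiberwise]
  simp

theorem sum_planeCount_sq (A : Finset V7) (φ : V7) :
    ∑ c, planeCount A φ c ^ 2 = ∑ x ∈ A, ∑ y ∈ A, if φ ⬝ᵥ (x - y) = 0 then 1 else 0 := by
  have h (c : ZMod 7) : planeCount A φ c ^ 2 =
      ∑ x ∈ A, ∑ y ∈ A, if φ ⬝ᵥ x = c ∧ φ ⬝ᵥ y = c then 1 else 0 := by
    simp only [planeCount, card_filter, Nat.cast_sum, sq, sum_mul_sum]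
    refine sum_congr rfl fun x _ => sum_congr rfl fun y _ => ?_
    by_cases h1 : φ ⬝ᵥ x = c <;> by_cases h2 : φ ⬝ᵥ y = c <;> simp [h1, h2]
  simp only [h]
  rw [sum_comm]
  refine sum_congr rfl fun x _ => ?_
  rw [sum_comm]
  refine sum_congr rfl fun y _ => ?_
  rw [sum_eq_single (φ ⬝ᵥ x)]
  · simp [dotProduct_sub, sub_eq_zero, eq_comm]
  · intro c _ hc
    simp [hc.symm]
  · simp

/-- Double count of pairs: a diagonal pair is unseparated by all of `D`, any other pair by `k`
functionals. -/
theorem sum_sum_planeCount_sq (A D : Finset V7) (k : ℕ)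
    (hk : ∀ x ∈ A, ∀ y ∈ A, x ≠ y → #{φ ∈ D | φ ⬝ᵥ (x - y) = 0} = k) :
    ∑ φ ∈ D, ∑ c, planeCount A φ c ^ 2 = (#A : ℤ) * #D + #A * (#A - 1) * k := by
  simp only [sum_planeCount_sq]
  rw [sum_comm]
  have h (x) (hx : x ∈ A) : ∑ φ ∈ D, ∑ y ∈ A, (if φ ⬝ᵥ (x - y) = 0 then 1 else 0 : ℤ) =
      #D + (#A - 1) * k := by
    rw [sum_comm, ← add_sum_erase _ _ hx]
    have : ∀ y ∈ A.erase x, ∑ φ ∈ D, (if φ ⬝ᵥ (x - y) = 0 then 1 else 0 : ℤ) = k := by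
      intro y hy
      rw [← hk x hx y (mem_of_mem_erase hy) (ne_of_mem_erase hy).symm, card_filter]
      push_cast
      rfl
    rw [sum_congr rfl this]
    have hpos : 1 ≤ #A := card_pos.2 ⟨x, hx⟩
    simp [card_erase_of_mem hx, Nat.cast_sub hpos]
  rw [sum_congr rfl h]
  simp
  ring

/-- A point on the axis lies in all seven planes, any other point of `φ ⬝ᵥ x = c` in none, and a
point off that plane in exactly one. -/
theorem sum_pencil (B : Finset V7) (φ ψ : V7) (c e : ZMod 7) :
    ∑ t : ZMod 7, planeCount B (ψ + t • φ) (e + t * c) =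
      7 * planeCount {b ∈ B | φ ⬝ᵥ b = c} ψ e + (#B - planeCount B φ c) := by
  have hB : (#B : ℤ) = ∑ b ∈ B, 1 := by simp
  simp only [planeCount, filter_filter, card_filter, Nat.cast_sum, mul_sum, hB]
  rw [sum_comm, ← sum_sub_distrib, ← sum_add_distrib]
  refine sum_congr rfl fun b _ => ?_
  simp only [add_dotProduct, smul_dotProduct, smul_eq_mul]
  by_cases h : φ ⬝ᵥ b = c
  · simp [h, ZMod.card]
  · have h0 : φ ⬝ᵥ b - c ≠ 0 := sub_ne_zero.2 h
    rw [sum_eq_single ((e - ψ ⬝ᵥ b) / (φ ⬝ᵥ b - c))]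
    · have : ψ ⬝ᵥ b + (e - ψ ⬝ᵥ b) / (φ ⬝ᵥ b - c) * (φ ⬝ᵥ b) =
          e + (e - ψ ⬝ᵥ b) / (φ ⬝ᵥ b - c) * c := by
        field_simp
        ring
      simp [h, this]
    · intro t _ ht
      rw [if_neg]
      · simp
      · intro h1
        apply ht
        rw [eq_div_iff h0]
        linear_combination h1
    · simp

/-! ### Extremal sums of squares -/

/-- By convexity the extreme case has as many terms as possible equal to `K` and one remainder. -/
theorem sum_sq_le_div_mod {ι : Type*} (s : Finset ι) (m : ι → ℕ) (K : ℕ) (hK : 0 < K)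
    (hm : ∀ i ∈ s, m i ≤ K) :
    ∑ i ∈ s, m i ^ 2 ≤ K ^ 2 * ((∑ i ∈ s, m i) / K) + ((∑ i ∈ s, m i) % K) ^ 2 := by
  classical
  induction s using Finset.induction_on with
  | empty => simp
  | insert a s ha ih =>
    rw [sum_insert ha, sum_insert ha]
    have ih' := ih fun i hi => hm i (mem_insert_of_mem hi)
    have hma := hm a (mem_insert_self _ _)
    generalize ∑ i ∈ s, m i = S at *
    have hr := Nat.mod_lt S hK
    have hS := Nat.div_add_mod S K
    generalize S / K = q at *
    generalize S % K = r at *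
    refine (Nat.add_le_add_left ih' _).trans ?_
    subst hS
    by_cases h : m a + r < K
    · have e : m a + (K * q + r) = (m a + r) + K * q := by ring
      rw [e, Nat.add_mul_div_left _ _ hK, Nat.add_mul_mod_self_left, Nat.div_eq_of_lt h,
        Nat.mod_eq_of_lt h]
      nlinarith [Nat.zero_le (m a * r)]
    · obtain ⟨u, hu⟩ := Nat.exists_eq_add_of_le (not_lt.1 h)
      have e : m a + (K * q + r) = u + K * (q + 1) := by rw [mul_add]; omega
      have hu' : u < K := by omega
      rw [e, Nat.add_mul_div_left _ _ hK, Nat.add_mul_mod_self_left, Nat.div_eq_of_lt hu',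
        Nat.mod_eq_of_lt hu']
      zify at *
      nlinarith [mul_nonneg (sub_nonneg.2 hma) (sub_nonneg.2 hr.le)]

theorem sum_sq_le_of_sum_eq {ι : Type*} (s : Finset ι) (m : ι → ℤ) (K S : ℕ) (hK : 0 < K)
    (h0 : ∀ i ∈ s, 0 ≤ m i) (hm : ∀ i ∈ s, m i ≤ K) (hS : ∑ i ∈ s, m i = S) :
    ∑ i ∈ s, m i ^ 2 ≤ (K ^ 2 * (S / K) + (S % K) ^ 2 : ℕ) := by
  have h1 (i) (hi : i ∈ s) : m i = ((m i).toNat : ℤ) := (Int.toNat_of_nonneg (h0 i hi)).symm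
  have h2 : ∑ i ∈ s, (m i).toNat = S := by
    zify
    rw [← hS]
    exact sum_congr rfl fun i hi => (h1 i hi).symm
  have := sum_sq_le_div_mod s (fun i => (m i).toNat) K hK fun i hi => by
    have := hm i hi
    omega
  rw [h2] at this
  refine le_trans (le_of_eq ?_) (Int.ofNat_le.2 this)
  push_cast
  exact sum_congr rfl fun i hi => by rw [← h1 i hi]

theorem card_eq_nine_mul_le {ι : Type*} (s : Finset ι) (m : ι → ℤ) (h0 : ∀ i ∈ s, 0 ≤ m i) :
    9 * (#{i ∈ s | m i = 9} : ℤ) ≤ ∑ i ∈ s, m i := by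
  rw [card_filter]
  push_cast
  rw [mul_sum]
  refine sum_le_sum fun i hi => ?_
  have := h0 i hi
  split_ifs <;> omega

/-- Bounds for the excesses of the seven further planes through a line with `d + 2` points
that lies in a plane with `22` points. -/
theorem pencil_bounds {m : ZMod 7 → ℤ} {d : ℤ} (h0 : ∀ t, 0 ≤ m t) (h9 : ∀ t, m t ≤ 9)
    (hs : ∑ t, m t = 7 * d + 1) :
    ∑ t, m t ^ 2 ≤ 4 * d ^ 2 + 41 * d + 19 - 18 * (if d = 0 then 1 else 0) ∧
      (#{t | m t = 9} : ℤ) ≤ d - 1 + (if d = 0 then 1 else 0) := by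
  have hd0 : 0 ≤ d := by
    have : 0 ≤ ∑ t, m t := sum_nonneg fun t _ => h0 t
    omega
  have hd8 : d ≤ 8 := by
    have : ∑ t, m t ≤ ∑ t : ZMod 7, 9 := sum_le_sum fun t _ => h9 t
    simp [ZMod.card] at this
    omega
  have h2 := card_eq_nine_mul_le univ m fun t _ => h0 t
  have h1 := sum_sq_le_of_sum_eq univ m 9 (7 * d + 1).toNat (by norm_num) (fun t _ => h0 t)
    (fun t _ => h9 t) (by rw [hs]; omega)
  rw [hs] at h2
  constructor
  · refine h1.trans ?_
    -- The quadratic interpolates the extremal values at `d` = 1, …, 5; the indicator corrects `d =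
    -- 0`.
    interval_cases d <;> norm_num
  · split_ifs <;> omega

/-- The number of points of `B` on the hyperplane `φ ⬝ᵥ x = c` beyond the thirteen that
Jamison's bound guarantees. -/
def excess (B : Finset V7) (φ : V7) (c : ZMod 7) : ℤ := planeCount B φ c - 13

/-! ### Counting planes of excess 9 -/

section Excess

variable {B : Finset V7}

theorem sum_excess (hcard : #B = 100) (φ : V7) : ∑ c, excess B φ c = 9 := by
  simp [excess, sum_planeCount, hcard, ZMod.card]

theorem excess_le (hcard : #B = 100) (h0 : ∀ φ ≠ 0, ∀ c, 0 ≤ excess B φ c) {φ : V7}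
    (hφ : φ ≠ 0) (c : ZMod 7) : excess B φ c ≤ 9 := by
  rw [← sum_excess hcard φ]
  exact single_le_sum (fun c _ => h0 φ hφ c) (mem_univ c)

theorem card_excess_eq_nine_le (hcard : #B = 100) (h0 : ∀ φ ≠ 0, ∀ c, 0 ≤ excess B φ c) {φ : V7}
    (hφ : φ ≠ 0) : #{c | excess B φ c = 9} ≤ 1 := by
  have := card_eq_nine_mul_le univ (excess B φ) fun c _ => h0 φ hφ c
  rw [sum_excess hcard] at this
  omega

theorem sum_excess_sq_le (hcard : #B = 100) (h0 : ∀ φ ≠ 0, ∀ c, 0 ≤ excess B φ c) {φ : V7}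
    (hφ : φ ≠ 0) :
    ∑ c, excess B φ c ^ 2 ≤ 65 + 16 * (#{c | excess B φ c = 9} : ℤ) := by
  by_cases h : ∃ c, excess B φ c = 9
  · have h1 : 0 < #{c | excess B φ c = 9} := by
      obtain ⟨c, hc⟩ := h
      exact card_pos.2 ⟨c, by simp [hc]⟩
    have h2 := sum_sq_le_of_sum_eq univ (excess B φ) 9 9 (by norm_num) (fun c _ => h0 φ hφ c)
      (fun c _ => excess_le hcard h0 hφ c) (by rw [sum_excess hcard]; rfl)
    norm_num at h2
    omega
  · push Not at h
    have h2 := sum_sq_le_of_sum_eq univ (excess B φ) 8 9 (by norm_num) (fun c _ => h0 φ hφ c)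
      (fun c _ => by
        have := excess_le hcard h0 hφ c
        have := h c
        push_cast
        omega) (by rw [sum_excess hcard]; rfl)
    norm_num at h2
    omega

theorem sum_excess_sq_eq (hcard : #B = 100) (φ : V7) :
    ∑ c, excess B φ c ^ 2 = ∑ c, planeCount B φ c ^ 2 - 1417 := by
  have h (c : ZMod 7) : excess B φ c ^ 2 = planeCount B φ c ^ 2 - 26 * planeCount B φ c + 169 := by
    unfold excess; ring
  simp only [h, sum_add_distrib, sum_sub_distrib, ← mul_sum, sum_planeCount, hcard]
  simp [ZMod.card]
  ring

theorem sum_sum_excess_sq (hcard : #B = 100) :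
    ∑ φ ∈ univ.erase (0 : V7), ∑ c, excess B φ c ^ 2 = 24786 := by
  simp only [sum_excess_sq_eq hcard, sum_sub_distrib]
  rw [sum_sum_planeCount_sq B _ 48 fun x _ y _ hxy => card_nonzero_orthogonal (sub_ne_zero.2 hxy)]
  simp [hcard, ZMod.card]

theorem sum_card_excess_eq_nine_ge (hcard : #B = 100) (h0 : ∀ φ ≠ 0, ∀ c, 0 ≤ excess B φ c) :
    (160 : ℤ) ≤ ∑ φ ∈ univ.erase (0 : V7), (#{c | excess B φ c = 9} : ℤ) := by
  have h := sum_le_sum fun φ (hφ : φ ∈ univ.erase (0 : V7)) =>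
    sum_excess_sq_le hcard h0 (ne_of_mem_erase hφ)
  rw [sum_sum_excess_sq hcard, sum_add_distrib, ← mul_sum] at h
  simp [ZMod.card, -sum_erase_eq_sub] at h
  -- 24786 - 342 · 65 = 2556 > 16 · 159.
  omega

theorem ne_zero_of_mem_transversal {φ ψ : V7} (h : ψ ∈ transversal φ) : ψ ≠ 0 := by
  rintro rfl
  exact mem_transversal.1 h 0 (by simp)

theorem add_smul_mem_transversal {φ ψ : V7} (t : ZMod 7) :
    ψ + t • φ ∈ transversal φ ↔ ψ ∈ transversal φ := by
  simp only [mem_transversal]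
  constructor
  · intro h s hs
    exact h (s + t) (by rw [add_smul, hs])
  · intro h s hs
    exact h (s - t) (by rw [sub_smul, hs]; simp)

/-- For each fixed `t`, the shift `(ψ, e) ↦ (ψ + t • φ, e + t * c)` permutes the pairs with `ψ`
transversal. -/
theorem sum_transversal_pencil (φ : V7) (c : ZMod 7) (F : V7 → ZMod 7 → ℤ) :
    ∑ ψ ∈ transversal φ, ∑ e, ∑ t : ZMod 7, F (ψ + t • φ) (e + t * c) =
      7 * ∑ ψ ∈ transversal φ, ∑ e, F ψ e := by
  have h (t : ZMod 7) : ∑ ψ ∈ transversal φ, ∑ e, F (ψ + t • φ) (e + t * c) =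
      ∑ ψ ∈ transversal φ, ∑ e, F ψ e := by
    refine (sum_congr rfl fun ψ _ =>
      Equiv.sum_comp (Equiv.addRight (t * c)) (F (ψ + t • φ))).trans ?_
    exact sum_equiv (Equiv.addRight (t • φ)) (by simp [add_smul_mem_transversal]) (by simp)
  have h' (ψ : V7) : ∑ e, ∑ t : ZMod 7, F (ψ + t • φ) (e + t * c) =
    ∑ t : ZMod 7, ∑ e, F (ψ + t • φ) (e + t * c) := sum_comm
  simp only [h']
  rw [sum_comm]
  simp only [h]
  simp [ZMod.card]

theorem sum_erase_zero_eq {φ : V7} (hφ : φ ≠ 0) (F : V7 → ℤ) :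
    ∑ ψ ∈ univ.erase (0 : V7), F ψ =
      ∑ ψ ∈ transversal φ, F ψ + ∑ t ∈ univ.erase (0 : ZMod 7), F (t • φ) := by
  have hsub : transversal φ ⊆ univ.erase 0 := fun ψ h => by
    simpa using ne_zero_of_mem_transversal h
  have himg : univ.erase (0 : V7) \ transversal φ =
      (univ.erase (0 : ZMod 7)).image (fun t => t • φ) := by
    ext ψ
    simp only [mem_sdiff, mem_erase, mem_univ, and_true, mem_transversal, mem_image, not_forall,
      not_not]
    constructor
    · rintro ⟨h1, t, rfl⟩
      exact ⟨t, fun ht => h1 (by simp [ht]), rfl⟩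
    · rintro ⟨t, ht, rfl⟩
      exact ⟨smul_ne_zero ht hφ, t, rfl⟩
  rw [← sum_sdiff hsub, himg, sum_image fun _ _ _ _ h => smul_left_injective _ hφ h]
  ring

theorem sum_transversal_excess_sq_ge (hcard : #B = 100) (h0 : ∀ φ ≠ 0, ∀ c, 0 ≤ excess B φ c)
    {φ : V7} (hφ : φ ≠ 0) : 24300 ≤ ∑ ψ ∈ transversal φ, ∑ e, excess B ψ e ^ 2 := by
  have h := sum_sum_excess_sq hcard
  rw [sum_erase_zero_eq hφ] at h
  have h1 : ∑ t ∈ univ.erase (0 : ZMod 7), ∑ e, excess B (t • φ) e ^ 2 ≤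
      ∑ t ∈ univ.erase (0 : ZMod 7), 81 := by
    refine sum_le_sum fun t ht => ?_
    have hne : t • φ ≠ 0 := smul_ne_zero (ne_of_mem_erase ht) hφ
    have h1 := sum_excess_sq_le hcard h0 hne
    have h2 := card_excess_eq_nine_le hcard h0 hne
    omega
  simp [ZMod.card, -sum_erase_eq_sub] at h1
  omega

theorem sum_card_excess_eq_nine_le (hcard : #B = 100) (h0 : ∀ φ ≠ 0, ∀ c, 0 ≤ excess B φ c)
    {φ : V7} (hφ : φ ≠ 0) : ∑ ψ ∈ univ.erase (0 : V7), (#{c | excess B ψ c = 9} : ℤ) ≤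
      ∑ ψ ∈ transversal φ, (#{c | excess B ψ c = 9} : ℤ) + 6 := by
  rw [sum_erase_zero_eq hφ]
  have h1 : ∑ t ∈ univ.erase (0 : ZMod 7), (#{c | excess B (t • φ) c = 9} : ℤ) ≤
      ∑ t ∈ univ.erase (0 : ZMod 7), 1 := by
    refine sum_le_sum fun t ht => ?_
    have hne : t • φ ≠ 0 := smul_ne_zero (ne_of_mem_erase ht) hφ
    exact_mod_cast card_excess_eq_nine_le hcard h0 hne
  simp [ZMod.card] at h1
  simpa using h1

/-- A plane with `22` points forces few planes with `22` points. -/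
theorem sum_card_excess_eq_nine_le_of_excess_eq_nine (hcard : #B = 100)
    (h0 : ∀ φ ≠ 0, ∀ c, 0 ≤ excess B φ c) {φ : V7} (hφ : φ ≠ 0) {c : ZMod 7}
    (hc : excess B φ c = 9) :
    ∑ ψ ∈ univ.erase (0 : V7), (#{e | excess B ψ e = 9} : ℤ) ≤ 144 := by
  set A : Finset V7 := {b ∈ B | φ ⬝ᵥ b = c} with hA
  have hA22 : (#A : ℤ) = 22 := by
    have : planeCount B φ c = #A := rfl
    unfold excess at hc
    omega
  let d (ψ : V7) (e : ZMod 7) : ℤ := planeCount A ψ e - 2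
  have hpencil (ψ : V7) (e : ZMod 7) :
      ∑ t : ZMod 7, excess B (ψ + t • φ) (e + t * c) = 7 * d ψ e + 1 := by
    have h1 := sum_pencil B φ ψ c e
    have h2 : planeCount B φ c = 22 := by unfold excess at hc; omega
    rw [← hA, h2, hcard] at h1
    simp only [excess, sum_sub_distrib, h1, d]
    simp [ZMod.card]
    ring
  have hbounds (ψ) (hψ : ψ ∈ transversal φ) (e : ZMod 7) :=
    have hne (t : ZMod 7) : ψ + t • φ ≠ 0 :=
      ne_zero_of_mem_transversal ((add_smul_mem_transversal t).2 hψ)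
    pencil_bounds (fun t => h0 _ (hne t) (e + t * c))
      (fun t => excess_le hcard h0 (hne t) (e + t * c)) (hpencil ψ e)
  have hd1 : ∑ ψ ∈ transversal φ, ∑ e, d ψ e = 2688 := by
    simp only [d, sum_sub_distrib, sum_planeCount, hA22]
    simp [card_transversal hφ, ZMod.card]
  have hd2 : ∑ ψ ∈ transversal φ, ∑ e, d ψ e ^ 2 = 6636 := by
    have h1 (ψ : V7) : ∑ e, d ψ e ^ 2 = ∑ e, planeCount A ψ e ^ 2 - 60 := by
      have h (e : ZMod 7) : d ψ e ^ 2 = planeCount A ψ e ^ 2 - 4 * planeCount A ψ e + 4 := by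
        simp only [d]; ring
      simp only [h, sum_add_distrib, sum_sub_distrib, ← mul_sum, sum_planeCount, hA22]
      simp [ZMod.card]
      ring
    simp only [h1, sum_sub_distrib]
    rw [sum_sum_planeCount_sq A _ 42 fun x hx y hy hxy =>
      card_transversal_orthogonal hφ (sub_ne_zero.2 hxy) (by
        rw [dotProduct_sub, (mem_filter.1 hx).2, (mem_filter.1 hy).2, sub_self])]
    simp [hA22, card_transversal hφ]
  -- `Z` counts the 2-point lines of the 22-point plane, each once per transversal equation.
  set Z : ℤ := ∑ ψ ∈ transversal φ, ∑ e, (if d ψ e = 0 then 1 else 0) with hZ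
  have hsq := sum_transversal_pencil φ c fun ψ e => excess B ψ e ^ 2
  have hsq' := sum_le_sum fun ψ hψ => sum_le_sum fun e (_ : e ∈ univ) => (hbounds ψ hψ e).1
  rw [hsq] at hsq'
  have hnine := sum_transversal_pencil φ c fun ψ e => if excess B ψ e = 9 then 1 else 0
  have hnine' := sum_le_sum fun ψ hψ => sum_le_sum fun e (_ : e ∈ univ) => (hbounds ψ hψ e).2
  simp only [card_filter, Nat.cast_sum, Nat.cast_ite, Nat.cast_one, Nat.cast_zero] at hnine'
  rw [hnine] at hnine'
  simp only [sum_add_distrib, sum_sub_distrib, ← mul_sum, hd1, hd2, ← hZ] at hsq' hnine'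
  simp [card_transversal hφ, ZMod.card] at hsq' hnine'
  have hge := sum_transversal_excess_sq_ge hcard h0 hφ
  have hle := sum_card_excess_eq_nine_le hcard h0 hφ
  simp only [card_filter, Nat.cast_sum, Nat.cast_ite, Nat.cast_one, Nat.cast_zero] at hle ⊢
  simp only [sum_boole] at hle hnine' ⊢
  -- Squares: 7 · 24300 ≤ 181440 - 18 `Z`, so `Z` ≤ 630. Nines: 7 N ≤ 336 + `Z`, so N ≤ 138
  -- transversally, plus 6 for the multiples of `φ`.
  omega

end Excess

theorem BlocksLines.card_ne_hundred {B : Finset V7} (hB : BlocksLines B) : #B ≠ 100 := by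
  intro hcard
  have h0 : ∀ φ ≠ 0, ∀ c, 0 ≤ excess B φ c := fun φ hφ c => by
    have := hB.thirteen_le hφ c
    unfold excess
    omega
  have hge := sum_card_excess_eq_nine_ge hcard h0
  obtain ⟨φ, hφ, hpos⟩ : ∃ φ ∈ univ.erase (0 : V7), 0 < (#{c | excess B φ c = 9} : ℤ) := by
    by_contra! h
    have := sum_nonpos h
    omega
  obtain ⟨c, hc⟩ := card_pos.1 (Nat.cast_pos.1 hpos)
  have := sum_card_excess_eq_nine_le_of_excess_eq_nine hcard h0 (ne_of_mem_erase hφ)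
    (mem_filter.1 hc).2
  omega

theorem blocksLines_compl {S : Finset V7} (hS : ProgressionFree 7 (S : Set V7)) :
    BlocksLines Sᶜ := by
  intro a d hd
  obtain ⟨i, hi⟩ := hS a d (by
    intro i j hij
    have h1 : ((i : ℕ) : ZMod 7) • d = ((j : ℕ) : ZMod 7) • d := by
      simpa only [Nat.cast_smul_eq_nsmul] using add_left_cancel hij
    have h2 := smul_left_injective _ hd h1
    rw [ZMod.natCast_eq_natCast_iff', Nat.mod_eq_of_lt i.2, Nat.mod_eq_of_lt j.2] at h2
    exact Fin.ext h2)
  exact ⟨i, i.2, by simpa using hi⟩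

theorem theorem6 : r 7 7 3 < 243 := by
  classical
  unfold r
  rw [Finset.sup_lt_iff (by norm_num)]
  intro S hS
  have hS' : ProgressionFree 7 (S : Set V7) := (mem_filter.1 hS).2
  by_contra! hlt
  obtain ⟨T, hTS, hT⟩ := exists_subset_card_eq hlt
  have hTfree : ProgressionFree 7 (T : Set V7) := fun a d had => by
    obtain ⟨i, hi⟩ := hS' a d had
    exact ⟨i, fun h => hi (hTS h)⟩
  apply (blocksLines_compl hTfree).card_ne_hundred
  rw [card_compl, hT]
  simp [ZMod.card]
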